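/- Let $n\ge 1$, let $\mathbf a$ be a finite set (the set of infinite places of a totally real field), let $\kappa=(\kappa_v)_{v\in\mathbf a}$ be a family of positive integers, and let $P\in\mathbb C[T]$ be a homogeneous polynomial of (total) degree $d$ in the entries $T_{v,i,j}$ of a family $T=(T_v)_{v\in\mathbf a}$ of $n\times n$ matrices of variables. Let $J_n=\begin{pmatrix}0&I_n\\-I_n&0\end{pmatrix}$, $\mathrm U(n,n)=\{g\in \mathrm{GL}_{2n}(\mathbb C): {}^t\overline g J_n g=J_n\}$, $G=\prod_{v\in\mathbf a}\mathrm U(n,n)$, and $\mathfrak H_n=\{Z\in M_n(\mathbb C): \tfrac1{2\sqrt{-1}}(Z-{}^t\overline Z)>0\}$. For $g=\begin{pmatrix}A_v&B_v\\C_v&D_v\end{pmatrix}_{v}\in G$, $Z=(Z_v)_v\in\mathfrak H_n^{\mathbf a}$ and $s\in\mathbb C$ put $$\delta_g(Z)^{-\kappa}=\prod_v\det(C_vZ_v+D_v)^{-\kappa_v},\qquad \Delta_g(Z)=\big((C_vZ_v+D_v)^{-1}C_v\big)_v,$$ $$\varrho(g;\kappa,s)=\prod_v|\det(\sqrt{-1}\,C_v+D_v)|^{\kappa_v-2s}\det(\sqrt{-1}\,C_v+D_v)^{-\kappa_v},\qquad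 \Delta(g)=\big((\sqrt{-1}\,C_v+D_v)^{-1}(C_v+\sqrt{-1}\,D_v)\big)_v .$$ Let $\partial_Z=(\partial/\partial Z_{v,i,j})$. Let $\pi^+=(\pi^+_{v,i,j})$, where $\pi^+_{v,i,j}$ has $v$-component $\mathfrak c\begin{pmatrix}0&e_{i,j}\\0&0\end{pmatrix}\mathfrak c^{-1}$ with $\mathfrak c=\frac1{\sqrt2}\begin{pmatrix}I_n&\sqrt{-1}I_n\\ \sqrt{-1}I_n&I_n\end{pmatrix}$ and zero components elsewhere, $e_{i,j}$ being the matrix unit; it is an element of the complexified Lie algebra of $G$ and acts on functions on $G$ by the complex-linear extension of $(Xf)(g)=\frac{d}{dt}f(g\exp(tX))|_{t=0}$. Write ${}^tT=({}^tT_v)_v$. (1) If $\kappa_v\ge n$ for all $v$, then for all $g\in G$ and $Z\in\mathfrak H_n^{\mathbf a}$ $$P(\partial_Z)\big(\delta_g(Z)^{-\kappa}\big)=\delta_g(Z)^{-\kappa}\,\phi_\kappa(P)\big({}^t\Delta_g(Z)\big),\qquad \phi_\kappa(P)(T)=(-1)^{d}\Big(P(\partial_W)\prod_v\det(I_n-W_v\,{}^tT_v)^{-\kappa_v}\Big)\Big|_{W=0}.$$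 (2) If $s\in\mathbb C$ and $\mathrm{Re}(\kappa_v/2+s)\ge n$ for all $v$, then for all $g\in G$ $$P(\pi^+)\varrho(g;\kappa,s)=\varrho(g;\kappa,s)\,\psi_{\kappa,s}(P)\big({}^t\Delta(g)\big),\qquad \psi_{\kappa,s}(P)(T)=(-1)^{d}\Big(P(\partial_W)\prod_v\det(I_n-W_v\,{}^tT_v)^{-(\kappa_v/2+s)}\Big)\Big|_{W=0},$$ with principal values of the powers near $W=0$. -/

import Mathlib

open scoped Matrix

noncomputable section

namespace HermitianDiff

/-! ### Polynomials in families of operators -/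

/-- `P(D) f` for a polynomial `P` in variables `T_x` (`x : σ`) and a family of operators `D_x` on
functions `X → ℂ`: every monomial `∏ T_x ^ ν_x` of `P` is replaced by the corresponding composition
of the operators `D_x`, applied to `f`. It is meant for families which commute on the functions under
consideration (partial derivatives on holomorphic functions, an abelian family of invariant vector
fields on smooth functions), so that the order of the composition is immaterial. -/
def polyApply {σ X : Type*} (D : σ → (X → ℂ) → (X → ℂ)) (P : MvPolynomial σ ℂ) (f : X → ℂ) :
    X → ℂ :=
  fun x => ∑ ν ∈ P.support, P.coeff ν * ((Finsupp.toMultiset ν).toList.foldr D f) x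

/-! ### Families of matrices and their holomorphic partial derivatives -/

/-- Families `Z = (Z_v)_v` of complex `n × n` matrices. -/
abbrev MatFam (a : Type*) (n : ℕ) : Type _ := a → Matrix (Fin n) (Fin n) ℂ

/-- Index set of the entries `Z_{v,i,j}` of such a family. -/
abbrev Entry (a : Type*) (n : ℕ) : Type _ := a × Fin n × Fin n

/-- The family whose only nonzero entry is a `1` at `(v,i,j)`. -/
def unitFam {a : Type*} [DecidableEq a] {n : ℕ} (x : Entry a n) : MatFam a n :=
  Pi.single x.1 (Matrix.single x.2.1 x.2.2 1)

/-- The holomorphic partial derivative `∂/∂Z_{v,i,j}` (of a function that is holomorphic near `Z`). -/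
def partialZ {a : Type*} [DecidableEq a] {n : ℕ} (x : Entry a n) (f : MatFam a n → ℂ) :
    MatFam a n → ℂ :=
  fun Z => deriv (fun t : ℂ => f (Z + t • unitFam x)) 0

/-- `Im Z = (Z - Z^*) / (2 i)`, the hermitian imaginary part. -/
def hermIm {n : ℕ} (Z : Matrix (Fin n) (Fin n) ℂ) : Matrix (Fin n) (Fin n) ℂ :=
  (1 / (2 * Complex.I)) • (Z - Zᴴ)

open scoped ComplexOrder in
/-- The product, over `v ∈ a`, of hermitian upper half spaces `{Z ∈ M_n(ℂ) | Im Z > 0}`. -/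
def upperHalf (a : Type*) (n : ℕ) : Set (MatFam a n) :=
  {Z | ∀ v, (hermIm (Z v)).PosDef}

/-! ### The group `U(n,n)` and its Lie algebra -/

/-- `J_n = (0, 1; -1, 0)`. -/
def J (n : ℕ) : Matrix (Fin n ⊕ Fin n) (Fin n ⊕ Fin n) ℂ := Matrix.fromBlocks 0 1 (-1) 0

theorem J_mul_J (n : ℕ) : J n * J n = -1 := by
  simp [J, Matrix.fromBlocks_multiply, ← Matrix.fromBlocks_one, Matrix.fromBlocks_neg]

theorem J_conjTranspose (n : ℕ) : (J n)ᴴ = -J n := by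
  simp [J, Matrix.fromBlocks_conjTranspose, Matrix.fromBlocks_neg]

/-- `U(n,n) = {g ∈ GL_{2n}(ℂ) | g^* J_n g = J_n}`. -/
def U (n : ℕ) : Subgroup (GL (Fin n ⊕ Fin n) ℂ) where
  carrier := {g | (g.1)ᴴ * J n * g.1 = J n}
  one_mem' := by simp
  mul_mem' := by
    intro g h hg hh
    simp only [Set.mem_ofPred_eq] at *
    rw [Units.val_mul, Matrix.conjTranspose_mul]
    calc (h.1)ᴴ * (g.1)ᴴ * J n * (g.1 * h.1) = (h.1)ᴴ * ((g.1)ᴴ * J n * g.1) * h.1 := by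
          simp only [Matrix.mul_assoc]
      _ = J n := by rw [hg, hh]
  inv_mem' := by
    intro g hg
    simp only [Set.mem_ofPred_eq] at *
    have h1 : g.1 * (g⁻¹).1 = 1 := g.mul_inv
    have h2 : ((g⁻¹).1)ᴴ * (g.1)ᴴ = 1 := by
      rw [← Matrix.conjTranspose_mul, h1, Matrix.conjTranspose_one]
    calc ((g⁻¹).1)ᴴ * J n * (g⁻¹).1 = ((g⁻¹).1)ᴴ * ((g.1)ᴴ * J n * g.1) * (g⁻¹).1 := by rw [hg]
      _ = (((g⁻¹).1)ᴴ * (g.1)ᴴ) * J n * (g.1 * (g⁻¹).1) := by simp only [Matrix.mul_assoc]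
      _ = J n := by rw [h1, h2]; simp

/-- The real Lie algebra `{X ∈ M_{2n}(ℂ) | X^* J_n + J_n X = 0}` of `U(n,n)`. -/
def lieU (n : ℕ) : Submodule ℝ (Matrix (Fin n ⊕ Fin n) (Fin n ⊕ Fin n) ℂ) where
  carrier := {X | Xᴴ * J n + J n * X = 0}
  zero_mem' := by simp
  add_mem' := by
    intro X Y hX hY
    simp only [Set.mem_ofPred_eq] at *
    rw [Matrix.conjTranspose_add, add_mul, mul_add, add_add_add_comm, hX, hY, add_zero]
  smul_mem' := by
    intro c X hX
    simp only [Set.mem_ofPred_eq] at *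
    rw [Matrix.conjTranspose_smul, star_trivial, Matrix.smul_mul, Matrix.mul_smul, ← smul_add, hX,
      smul_zero]

theorem exp_mem {n : ℕ} (X : lieU n) :
    (NormedSpace.exp X.1)ᴴ * J n * NormedSpace.exp X.1 = J n := by
  have hJ : IsUnit (J n) :=
    ⟨⟨J n, -J n, by rw [mul_neg, J_mul_J, neg_neg], by rw [neg_mul, J_mul_J, neg_neg]⟩, rfl⟩
  have hJi : (J n)⁻¹ = -J n :=
    Matrix.inv_eq_right_inv (by rw [mul_neg, J_mul_J, neg_neg])
  have hX : (X.1)ᴴ * J n + J n * X.1 = 0 := X.2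
  have hX' : (X.1)ᴴ = J n * (-X.1) * (J n)⁻¹ := by
    have h : (X.1)ᴴ * J n = J n * (-X.1) := by
      rw [mul_neg]; exact eq_neg_of_add_eq_zero_left hX
    rw [← h, hJi, Matrix.mul_assoc, mul_neg, J_mul_J]; simp
  rw [← Matrix.exp_conjTranspose, hX', Matrix.exp_conj _ _ hJ, hJi]
  have h1 : NormedSpace.exp (-X.1) * NormedSpace.exp X.1 = 1 := by
    rw [← Matrix.exp_add_of_commute _ _ (Commute.refl X.1).neg_left]; simp
  calc J n * NormedSpace.exp (-X.1) * -J n * J n * NormedSpace.exp X.1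
      = J n * (NormedSpace.exp (-X.1) * (-(J n * J n)) * NormedSpace.exp X.1) := by
        simp only [Matrix.mul_assoc, neg_mul, mul_neg]
    _ = J n := by rw [J_mul_J, neg_neg, Matrix.mul_one, h1, Matrix.mul_one]

/-- The exponential map from the Lie algebra to `U(n,n)`. -/
def expU {n : ℕ} (X : lieU n) : U n :=
  ⟨⟨NormedSpace.exp X.1, NormedSpace.exp (-X.1),
      by rw [← Matrix.exp_add_of_commute _ _ (Commute.refl X.1).neg_right]; simp,
      by rw [← Matrix.exp_add_of_commute _ _ (Commute.refl X.1).neg_left]; simp⟩,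
    exp_mem X⟩

/-- `(X f)(g) = d/dt f(g exp(tX))` at `t = 0`, for `X` in the Lie algebra of `∏_v U(n,n)`. -/
def rightDeriv {a : Type*} {n : ℕ} (X : a → lieU n) (f : (a → U n) → ℂ) : (a → U n) → ℂ :=
  fun g => deriv (fun t : ℝ => f (g * fun v => expU (t • X v))) 0

/-! Since `M_{2n}(ℂ) = Lie U(n,n) ⊕ i Lie U(n,n)`, the complexified Lie algebra is `M_{2n}(ℂ)`. The
complex conjugation of `M_{2n}(ℂ)` with respect to this real form is `X ↦ -J⁻¹ X^* J = J X^* J`. -/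

/-- The component `X₁` of `X = X₁ + i X₂` with `X₁, X₂` in the Lie algebra of `U(n,n)`. -/
def lieRe {n : ℕ} (X : Matrix (Fin n ⊕ Fin n) (Fin n ⊕ Fin n) ℂ) : lieU n :=
  ⟨(1 / 2 : ℂ) • (X + J n * Xᴴ * J n), by
    change ((1 / 2 : ℂ) • (X + J n * Xᴴ * J n))ᴴ * J n +
      J n * ((1 / 2 : ℂ) • (X + J n * Xᴴ * J n)) = 0
    have e1 : J n * X * J n * J n = -(J n * X) := by
      rw [Matrix.mul_assoc _ (J n), J_mul_J]; simp
    have e2 : J n * (J n * Xᴴ * J n) = -(Xᴴ * J n) := by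
      rw [← Matrix.mul_assoc, ← Matrix.mul_assoc, J_mul_J]; simp
    simp only [Matrix.conjTranspose_smul, Matrix.conjTranspose_add, Matrix.conjTranspose_mul,
      Matrix.conjTranspose_conjTranspose, J_conjTranspose, Matrix.smul_mul, Matrix.mul_smul,
      add_mul, mul_add, neg_mul, mul_neg, neg_neg, ← Matrix.mul_assoc (J n) X (J n), e1, e2]
    simp⟩

/-- The component `X₂` of `X = X₁ + i X₂` with `X₁, X₂` in the Lie algebra of `U(n,n)`. -/
def lieIm {n : ℕ} (X : Matrix (Fin n ⊕ Fin n) (Fin n ⊕ Fin n) ℂ) : lieU n :=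
  lieRe ((-Complex.I) • X)

theorem lieRe_add_lieIm {n : ℕ} (X : Matrix (Fin n ⊕ Fin n) (Fin n ⊕ Fin n) ℂ) :
    (lieRe X).1 + Complex.I • (lieIm X).1 = X := by
  simp only [lieIm, lieRe, Matrix.conjTranspose_smul, Matrix.smul_mul, Matrix.mul_smul,
    smul_add, smul_smul]
  have h1 : Complex.I * (1 / 2 * -Complex.I) = 1 / 2 := by
    linear_combination (-1 / 2 : ℂ) * Complex.I_mul_I
  have h2 : Complex.I * (1 / 2 * star (-Complex.I)) = -(1 / 2) := by
    simp only [star_neg, Complex.star_def, Complex.conj_I, neg_neg]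
    linear_combination (1 / 2 : ℂ) * Complex.I_mul_I
  rw [h1, h2, neg_smul]
  have h3 : X = (1 / 2 : ℂ) • X + (1 / 2 : ℂ) • X := by rw [← add_smul]; norm_num
  conv_rhs => rw [h3]
  abel

/-- The action of the complexified Lie algebra: the complex-linear extension of `rightDeriv`. -/
def rightDerivC {a : Type*} {n : ℕ} (X : a → Matrix (Fin n ⊕ Fin n) (Fin n ⊕ Fin n) ℂ)
    (f : (a → U n) → ℂ) : (a → U n) → ℂ :=
  fun g => rightDeriv (fun v => lieRe (X v)) f g +
    Complex.I * rightDeriv (fun v => lieIm (X v)) f g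

/-- The Cayley matrix `c = (1/√2) (1, i; i, 1)`. -/
def cayley (n : ℕ) : Matrix (Fin n ⊕ Fin n) (Fin n ⊕ Fin n) ℂ :=
  (1 / (Real.sqrt 2 : ℂ)) • Matrix.fromBlocks 1 (Complex.I • 1) (Complex.I • 1) 1

/-- `π⁺_{v,i,j}`: the element `c (0, e_{i,j}; 0, 0) c⁻¹` in the `v`-th component. -/
def piPlus {a : Type*} [DecidableEq a] {n : ℕ} (x : Entry a n) :
    a → Matrix (Fin n ⊕ Fin n) (Fin n ⊕ Fin n) ℂ :=
  Pi.single x.1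
    (cayley n * Matrix.fromBlocks 0 (Matrix.single x.2.1 x.2.2 1) 0 0 * (cayley n)⁻¹)

/-! ### The functions attached to `g = (A, B; C, D)` -/

/-- The block `C` of `g = (A, B; C, D)`. -/
def blockC {n : ℕ} (g : U n) : Matrix (Fin n) (Fin n) ℂ := g.1.1.toBlocks₂₁

/-- The block `D` of `g = (A, B; C, D)`. -/
def blockD {n : ℕ} (g : U n) : Matrix (Fin n) (Fin n) ℂ := g.1.1.toBlocks₂₂

/-- `i_n = i • 1_n`. -/
def iPt (n : ℕ) : Matrix (Fin n) (Fin n) ℂ := Complex.I • 1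

/-- `δ_g(Z)^{-κ} = ∏_v det(C_v Z_v + D_v)^{-κ_v}`. -/
def deltaPow {a : Type*} [Fintype a] {n : ℕ} (κ : a → ℕ) (g : a → U n) (Z : MatFam a n) : ℂ :=
  ∏ v, (blockC (g v) * Z v + blockD (g v)).det ^ (-(κ v : ℤ))

/-- `Δ_g(Z) = ((C_v Z_v + D_v)⁻¹ C_v)_v`. -/
def DeltaZ {a : Type*} {n : ℕ} (g : a → U n) (Z : MatFam a n) : MatFam a n :=
  fun v => (blockC (g v) * Z v + blockD (g v))⁻¹ * blockC (g v)

/-- `ϱ(g; κ, s) = ∏_v |det(C_v i_n + D_v)|^{κ_v - 2s} det(C_v i_n + D_v)^{-κ_v}`. -/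
def rhoFun {a : Type*} [Fintype a] {n : ℕ} (κ : a → ℕ) (s : ℂ) (g : a → U n) : ℂ :=
  ∏ v, ((‖(blockC (g v) * iPt n + blockD (g v)).det‖ : ℝ) : ℂ) ^ ((κ v : ℂ) - 2 * s) *
    (blockC (g v) * iPt n + blockD (g v)).det ^ (-(κ v : ℤ))

/-- `Δ(g) = ((C_v i_n + D_v)⁻¹ (C_v + D_v i_n))_v`. -/
def DeltaG {a : Type*} {n : ℕ} (g : a → U n) : MatFam a n :=
  fun v => (blockC (g v) * iPt n + blockD (g v))⁻¹ * (blockC (g v) + blockD (g v) * iPt n)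

/-- `φ_κ(P)(T) = (-1)^d (P(∂_W) ∏_v det(1 - W_v ᵗT_v)^{-κ_v})|_{W=0}`, for `P` homogeneous of
total degree `d`. -/
def phi {a : Type*} [Fintype a] [DecidableEq a] {n : ℕ} (κ : a → ℕ) (d : ℕ)
    (P : MvPolynomial (Entry a n) ℂ) (T : MatFam a n) : ℂ :=
  (-1) ^ d * polyApply partialZ P
    (fun W : MatFam a n => ∏ v, (1 - W v * (T v)ᵀ).det ^ (-(κ v : ℤ))) 0

/-- `ψ_{κ,s}(P)(T) = (-1)^d (P(∂_W) ∏_v det(1 - W_v ᵗT_v)^{-(κ_v/2+s)})|_{W=0}`, for `P` homogeneous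
of total degree `d`; the powers are principal values, holomorphic near `W = 0`. -/
def psi {a : Type*} [Fintype a] [DecidableEq a] {n : ℕ} (κ : a → ℕ) (s : ℂ) (d : ℕ)
    (P : MvPolynomial (Entry a n) ℂ) (T : MatFam a n) : ℂ :=
  (-1) ^ d * polyApply partialZ P
    (fun W : MatFam a n => ∏ v, (1 - W v * (T v)ᵀ).det ^ (-((κ v : ℂ) / 2 + s))) 0

end HermitianDiff

end

/-! Both formulas are proved one monomial at a time, for iterated operators along a list of length
`d`; homogeneity makes the sign `(-1)^d` uniform.

Part (1) is a change of variables. Since `det (C (Z + W) + D) = det (C Z + D) * det (1 + W Δ)`, the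
function `W ↦ deltaPow κ g (Z + W)` is a constant times the generating function of `phi` at `-W`.
Translating commutes with `∂_Z`, and the reflection gives `(-1)^d` (`polyApply_deltaPow`).

Part (2) compares two recursions. With `E` the unit family, set `T = (1 + S W)⁻¹ S`. Differentiating
along `E` multiplies `∏ det (1 + S W) ^ (-α)` by `-∑ α tr (T E)` and sends `T` to `-T E T`. Hence
every iterated derivative is the product times a polynomial in `T`, given recursively by `jetPoly`.
On the group, `π⁺` acts on `ϱ` and `Δ` by the same two rules with `α = κ/2 + s` and `T = Δ(g)`
(`rightDerivC_rhoFun_mul_evalFam`). So the same polynomials occur, and `W = 0`, where `T = S =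
Δ(g)`, gives the claim. -/

noncomputable section

namespace HermitianDiff

/-! ### Derivatives along curves of matrices, over `ℝ` or `ℂ` -/

section Curves

open scoped Matrix.Norms.Operator

variable {𝕜 : Type*} [RCLike 𝕜] [NormedAlgebra 𝕜 ℂ] {ι : Type*} [Fintype ι] {t₀ : 𝕜}

theorem hasDerivAt_matrix_iff {M : 𝕜 → Matrix ι ι ℂ} {M' : Matrix ι ι ℂ} :
    HasDerivAt M M' t₀ ↔ ∀ k l, HasDerivAt (fun t => M t k l) (M' k l) t₀ := by
  refine Iff.trans (hasDerivAt_pi (φ := M) (φ' := M')) ?_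
  exact forall_congr' fun k => hasDerivAt_pi (φ := fun t => M t k) (φ' := M' k)

variable [DecidableEq ι]

/-- Jacobi's formula. In the Leibniz expansion, the terms differentiating column `i` sum to the
determinant with that column replaced, which by Cramer is the `i`-th diagonal entry of `adj(M) M'`.
-/
theorem hasDerivAt_det {M : 𝕜 → Matrix ι ι ℂ} {M' : Matrix ι ι ℂ} (hM : HasDerivAt M M' t₀)
    (h0 : (M t₀).det ≠ 0) :
    HasDerivAt (fun t => (M t).det) ((M t₀).det * ((M t₀)⁻¹ * M').trace) t₀ := by
  rw [hasDerivAt_matrix_iff] at hM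
  have h : HasDerivAt (fun t => (M t).det)
      (∑ σ : Equiv.Perm ι, ((Equiv.Perm.sign σ : ℤ) : ℂ) *
        ∑ i, (∏ j ∈ Finset.univ.erase i, M t₀ (σ j) j) • M' (σ i) i) t₀ := by
    simp only [Matrix.det_apply']
    exact HasDerivAt.fun_sum fun σ _ => (HasDerivAt.fun_finsetProd fun i _ => hM (σ i) i).const_mul _
  convert h using 1
  have e1 : (M t₀).det • (M t₀)⁻¹ = (M t₀).adjugate := by
    rw [Matrix.inv_def, smul_smul, Ring.mul_inverse_cancel _ h0.isUnit, one_smul]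
  rw [← smul_eq_mul, ← Matrix.trace_smul, ← Matrix.smul_mul, e1]
  simp only [Finset.mul_sum]
  rw [Finset.sum_comm, Matrix.trace]
  refine Finset.sum_congr rfl fun i _ => ?_
  have e2 : ((M t₀).adjugate * M').diag i = ((M t₀).updateCol i fun k => M' k i).det := by
    rw [← Matrix.cramer_apply, Matrix.cramer_eq_adjugate_mulVec]
    rfl
  rw [e2, Matrix.det_apply']
  refine Finset.sum_congr rfl fun σ _ => ?_
  rw [← Finset.mul_prod_erase _ _ (Finset.mem_univ i), Matrix.updateCol_self, smul_eq_mul,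
    mul_comm (M' _ _)]
  congr 2
  refine Finset.prod_congr rfl fun j hj => ?_
  rw [Matrix.updateCol_ne (Finset.ne_of_mem_erase hj)]

/-- The derivative is expressed through `D⁻¹ C` itself, so that the curve satisfies a Riccati
equation; this is what closes the recursion. -/
theorem hasDerivAt_inv_mul {D C : 𝕜 → Matrix ι ι ℂ} {D' C' : Matrix ι ι ℂ}
    (hD : HasDerivAt D D' t₀) (hC : HasDerivAt C C' t₀) (h0 : (D t₀).det ≠ 0) :
    HasDerivAt (fun t => (D t)⁻¹ * C t)
      ((D t₀)⁻¹ * C' - (D t₀)⁻¹ * D' * ((D t₀)⁻¹ * C t₀)) t₀ := by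
  obtain ⟨u, hu⟩ : IsUnit (D t₀) := (Matrix.isUnit_iff_isUnit_det _).2 h0.isUnit
  have hi : HasDerivAt (fun t => (D t)⁻¹) (-((D t₀)⁻¹ * D' * (D t₀)⁻¹)) t₀ := by
    have h1 := hasFDerivAt_ringInverse (𝕜 := 𝕜) u
    rw [hu] at h1
    refine ((h1.comp_hasDerivAt t₀ hD).congr_deriv ?_).congr_of_eventuallyEq
      (.of_forall fun t => Matrix.nonsing_inv_eq_ringInverse _)
    simp [← hu]
  refine (hi.fun_mul hC).congr_deriv ?_
  noncomm_ring

theorem hasDerivAt_prod_of_log {a : Type*} [Fintype a] {f : a → 𝕜 → ℂ} {m : a → ℂ}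
    (h : ∀ v, HasDerivAt (f v) (f v t₀ * m v) t₀) :
    HasDerivAt (fun t => ∏ v, f v t) ((∏ v, f v t₀) * ∑ v, m v) t₀ := by
  classical
  refine (HasDerivAt.fun_finsetProd (u := Finset.univ) fun v _ => h v).congr_deriv ?_
  rw [Finset.mul_sum]
  refine Finset.sum_congr rfl fun v _ => ?_
  rw [smul_eq_mul, ← mul_assoc, Finset.prod_erase_mul _ _ (Finset.mem_univ v)]

theorem hasDerivAt_eval {σ : Type*} [Fintype σ] {T : 𝕜 → σ → ℂ} {T' : σ → ℂ}
    (hT : ∀ y, HasDerivAt (fun t => T t y) (T' y) t₀) (Q : MvPolynomial σ ℂ) :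
    HasDerivAt (fun t => MvPolynomial.eval (T t) Q)
      (∑ y, T' y * MvPolynomial.eval (T t₀) (MvPolynomial.pderiv y Q)) t₀ := by
  classical
  induction Q using MvPolynomial.induction_on with
  | C c => simpa using hasDerivAt_const t₀ c
  | add p q hp hq =>
    simp only [map_add]
    refine (hp.fun_add hq).congr_deriv ?_
    simp [mul_add, Finset.sum_add_distrib]
  | mul_X p y hp =>
    simp only [map_mul, MvPolynomial.eval_X]
    refine (hp.fun_mul (hT y)).congr_deriv ?_
    simp only [MvPolynomial.pderiv_mul, MvPolynomial.pderiv_X, map_add, map_mul,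
      MvPolynomial.eval_X, mul_add, Finset.sum_add_distrib, Finset.sum_mul, mul_assoc]
    congr 1
    rw [Finset.sum_eq_single y]
    · simp [mul_comm]
    · intro z _ hz; simp [hz.symm]
    · simp

end Curves

section Jets

variable {a : Type*} [DecidableEq a] {n : ℕ}

/-! ### Formal behaviour of iterated partial derivatives -/

/-- This and the next two identities need no differentiability: the underlying rules for `deriv`
hold for arbitrary functions over a field, default values included. -/
theorem foldr_partialZ_const_mul (c : ℂ) (f : MatFam a n → ℂ) (L : List (Entry a n)) :
    L.foldr partialZ (fun W => c * f W) = fun W => c * L.foldr partialZ f W := by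
  induction L with
  | nil => rfl
  | cons x L ih =>
    funext W
    simp only [List.foldr_cons, ih, partialZ]
    exact deriv_const_mul_field c

theorem foldr_partialZ_translate (Z : MatFam a n) (f : MatFam a n → ℂ) (L : List (Entry a n)) :
    L.foldr partialZ (fun W => f (Z + W)) = fun W => L.foldr partialZ f (Z + W) := by
  induction L with
  | nil => rfl
  | cons x L ih =>
    funext W
    simp only [List.foldr_cons, ih, partialZ, add_assoc]

theorem foldr_partialZ_neg (f : MatFam a n → ℂ) (L : List (Entry a n)) :
    L.foldr partialZ (fun W => f (-W)) =
      fun W => (-1) ^ L.length * L.foldr partialZ f (-W) := by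
  induction L with
  | nil => simp
  | cons x L ih =>
    funext W
    simp only [List.foldr_cons, ih, partialZ, List.length_cons, pow_succ, mul_assoc]
    rw [deriv_const_mul_field]
    congr 1
    have h := deriv_comp_neg (fun t : ℂ => L.foldr partialZ f (-W + t • unitFam x)) 0
    rw [neg_zero] at h
    rw [neg_one_mul, ← h]
    congr 1
    funext t
    rw [neg_add, neg_smul]

variable [Fintype a]

/-! ### The polynomials describing iterated derivatives of powers of determinants -/

/-- The generic matrix in the variables of index `v`. -/
def genMat (v : a) : Matrix (Fin n) (Fin n) (MvPolynomial (Entry a n) ℂ) :=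
  Matrix.of fun k l => MvPolynomial.X (v, k, l)

/-- The value of a polynomial in the entries at a family of matrices. -/
def evalFam (T : MatFam a n) (Q : MvPolynomial (Entry a n) ℂ) : ℂ :=
  MvPolynomial.eval (fun y : Entry a n => T y.1 y.2.1 y.2.2) Q

/-- The polynomial `Q` in the entries of `T = (1 + S W)⁻¹ S` such that the iterated derivative along
the list equals `Q(T)` times `∏_v det(1 + S_v W_v) ^ (-α_v)`. -/
def jetPoly (α : a → ℂ) : List (Entry a n) → MvPolynomial (Entry a n) ℂ
  | [] => 1
  | x :: L =>
    (∑ v, MvPolynomial.C (-α v) * (genMat v * (unitFam x v).map MvPolynomial.C).trace) *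
        jetPoly α L -
      ∑ y : Entry a n, (genMat y.1 * (unitFam x y.1).map MvPolynomial.C * genMat y.1 :
          Matrix (Fin n) (Fin n) (MvPolynomial (Entry a n) ℂ)) y.2.1 y.2.2 *
        MvPolynomial.pderiv y (jetPoly α L)

omit [DecidableEq a] [Fintype a] in
theorem genMat_map_eval (T : MatFam a n) (v : a) :
    (genMat v).map (MvPolynomial.eval fun y : Entry a n => T y.1 y.2.1 y.2.2) = T v := by
  ext k l
  simp [genMat]

/-- The recursion in numerical form, used on both sides of the comparison. The first sum is the
logarithmic derivative of the scalar factor, the second the chain rule for `T' = -T E T`. -/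
theorem evalFam_jetPoly_cons (α : a → ℂ) (x : Entry a n) (L : List (Entry a n)) (T : MatFam a n) :
    evalFam T (jetPoly α (x :: L)) =
      (∑ v, -α v * (T v * unitFam x v).trace) * evalFam T (jetPoly α L) -
        ∑ y : Entry a n, (T y.1 * unitFam x y.1 * T y.1) y.2.1 y.2.2 *
          evalFam T (MvPolynomial.pderiv y (jetPoly α L)) := by
  set φ := MvPolynomial.eval fun y : Entry a n => T y.1 y.2.1 y.2.2 with hφ
  have hE (v : a) : ((unitFam x v).map MvPolynomial.C).map φ = unitFam x v := by
    ext k l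
    simp [φ]
  have h1 (v : a) : φ (genMat v * (unitFam x v).map MvPolynomial.C :
      Matrix (Fin n) (Fin n) (MvPolynomial (Entry a n) ℂ)).trace =
      (T v * unitFam x v).trace := by
    have h : (T v * unitFam x v).trace =
        ((genMat v * (unitFam x v).map MvPolynomial.C).map φ).trace := by
      rw [Matrix.map_mul, hE v, hφ, genMat_map_eval]
    rw [h, Matrix.trace, Matrix.trace, map_sum]
    simp only [Matrix.diag_apply, Matrix.map_apply]
  have h2 (v : a) (k l) : φ ((genMat v * (unitFam x v).map MvPolynomial.C * genMat v :
      Matrix (Fin n) (Fin n) (MvPolynomial (Entry a n) ℂ)) k l) =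
      (T v * unitFam x v * T v) k l := by
    have h : T v * unitFam x v * T v =
        (genMat v * (unitFam x v).map MvPolynomial.C * genMat v).map φ := by
      rw [Matrix.map_mul, Matrix.map_mul, hE v, hφ, genMat_map_eval]
    rw [h, Matrix.map_apply]
  simp only [jetPoly, evalFam, map_sub, map_mul, map_sum, ← hφ, h1, h2]
  simp only [φ, MvPolynomial.eval_C]

omit [DecidableEq a] in
open scoped Matrix.Norms.Operator in
/-- The derivative of `r · Q(D⁻¹ C)` along a curve, with `m` the logarithmic derivative of `r`. -/
theorem hasDerivAt_mul_evalFam {𝕜 : Type*} [RCLike 𝕜] [NormedAlgebra 𝕜 ℂ] {t₀ : 𝕜}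
    {r : 𝕜 → ℂ} {m : ℂ} {D C : a → 𝕜 → Matrix (Fin n) (Fin n) ℂ} {D' C' : MatFam a n}
    (hr : HasDerivAt r (r t₀ * m) t₀)
    (hD : ∀ v, HasDerivAt (D v) (D' v) t₀) (hC : ∀ v, HasDerivAt (C v) (C' v) t₀)
    (h0 : ∀ v, (D v t₀).det ≠ 0) (Q : MvPolynomial (Entry a n) ℂ) :
    HasDerivAt (fun t => r t * evalFam (fun v => (D v t)⁻¹ * C v t) Q)
      (r t₀ * (m * evalFam (fun v => (D v t₀)⁻¹ * C v t₀) Q +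
        ∑ y : Entry a n, ((D y.1 t₀)⁻¹ * C' y.1 -
            (D y.1 t₀)⁻¹ * D' y.1 * ((D y.1 t₀)⁻¹ * C y.1 t₀)) y.2.1 y.2.2 *
          evalFam (fun v => (D v t₀)⁻¹ * C v t₀) (MvPolynomial.pderiv y Q))) t₀ := by
  have h := hasDerivAt_eval (fun y : Entry a n =>
    hasDerivAt_matrix_iff.1 (hasDerivAt_inv_mul (hD y.1) (hC y.1) (h0 y.1)) y.2.1 y.2.2) Q
  refine (hr.fun_mul h).congr_deriv ?_
  rw [mul_add, mul_assoc]
  rfl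

open scoped Matrix.Norms.Operator in
theorem foldr_partialZ_prod_det_cpow (α : a → ℂ) (T : MatFam a n) (L : List (Entry a n))
    (W : MatFam a n) (hW : ∀ v, (1 + T v * W v).det ∈ Complex.slitPlane) :
    L.foldr partialZ (fun W => ∏ v, (1 + T v * W v).det ^ (-α v)) W =
      (∏ v, (1 + T v * W v).det ^ (-α v)) *
        evalFam (fun v => (1 + T v * W v)⁻¹ * T v) (jetPoly α L) := by
  induction L generalizing W with
  | nil => simp [jetPoly, evalFam]
  | cons x L ih =>
    have hD (v : a) : HasDerivAt (fun t : ℂ => 1 + T v * (W + t • unitFam x) v)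
        (T v * unitFam x v) 0 := by
      have h1 : HasDerivAt (fun t : ℂ => t • (T v * unitFam x v)) (T v * unitFam x v) 0 := by
        exact ((hasDerivAt_id (0 : ℂ)).smul_const (T v * unitFam x v)).congr_deriv (one_smul _ _)
      refine (h1.const_add (1 + T v * W v)).congr_of_eventuallyEq (.of_forall fun t => ?_)
      simp [Matrix.mul_add, add_assoc]
    have e0 : W + (0 : ℂ) • unitFam x = W := by simp
    have h0 (v : a) : (1 + T v * (W + (0 : ℂ) • unitFam x) v).det ≠ 0 := by
      rw [e0]; exact Complex.slitPlane_ne_zero (hW v)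
    have hdet (v : a) := hasDerivAt_det (hD v) (h0 v)
    -- The slit plane is open, so the induction hypothesis holds on a whole neighbourhood of `t = 0`
    -- and may be differentiated.
    have hev : ∀ᶠ t : ℂ in nhds 0, ∀ v,
        (1 + T v * (W + t • unitFam x) v).det ∈ Complex.slitPlane := by
      rw [Filter.eventually_all]
      intro v
      refine (hdet v).continuousAt.eventually_mem (Complex.isOpen_slitPlane.mem_nhds ?_)
      simpa using hW v
    have hr : HasDerivAt (fun t : ℂ => ∏ v, (1 + T v * (W + t • unitFam x) v).det ^ (-α v))
        ((∏ v, (1 + T v * (W + (0 : ℂ) • unitFam x) v).det ^ (-α v)) *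
          ∑ v, -α v * ((1 + T v * (W + (0 : ℂ) • unitFam x) v)⁻¹ * (T v * unitFam x v)).trace)
        0 := by
      refine hasDerivAt_prod_of_log fun v => ?_
      refine ((hdet v).cpow_const (by simpa using hW v)).congr_deriv ?_
      have hz := h0 v
      generalize (1 + T v * (W + (0 : ℂ) • unitFam x) v).det = z at hz ⊢
      rw [Complex.cpow_sub _ _ hz, Complex.cpow_one]
      field_simp
    have key := hasDerivAt_mul_evalFam hr hD (fun v => hasDerivAt_const (0 : ℂ) (T v)) h0
      (jetPoly α L)
    rw [List.foldr_cons, partialZ]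
    have hfun : (fun t : ℂ => L.foldr partialZ (fun W => ∏ v, (1 + T v * W v).det ^ (-α v))
        (W + t • unitFam x)) =ᶠ[nhds 0] _ := hev.mono fun t ht => ih _ ht
    rw [hfun.deriv_eq, key.deriv, e0, evalFam_jetPoly_cons]
    simp only [Matrix.mul_zero, zero_sub, Matrix.neg_apply, neg_mul, Finset.sum_neg_distrib,
      Matrix.mul_assoc]
    rw [← sub_eq_add_neg]

end Jets

section Group

variable {n : ℕ}

/-! ### The automorphy factors and the complexified Lie algebra -/

theorem U_mem (g : U n) : (g.1.1)ᴴ * J n * g.1.1 = J n := g.2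

theorem J_form (x y : Fin n → ℂ) :
    star (Sum.elim x y) ⬝ᵥ (J n *ᵥ Sum.elim x y) = star x ⬝ᵥ y - star y ⬝ᵥ x := by
  have h : star (Sum.elim x y) = Sum.elim (star x) (star y) := by
    ext (i | i) <;> rfl
  rw [h, J, Matrix.fromBlocks_mulVec]
  simp [dotProduct, Matrix.neg_mulVec, sub_eq_add_neg, mul_comm]

-- If `(C Z + D) x = 0`, then `g` maps `(Z x, x)` to a vector `(u, 0)`, which is isotropic for `J`.
-- But `g` preserves the form, whose value at `(Z x, x)` is `-2i x^* (Im Z) x`, nonzero for `x ≠ 0`.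
open scoped ComplexOrder in
theorem det_blockC_mul_add_blockD_ne_zero (g : U n) {Z : Matrix (Fin n) (Fin n) ℂ}
    (hZ : (hermIm Z).PosDef) : (blockC g * Z + blockD g).det ≠ 0 := by
  intro h
  obtain ⟨x, hx, hx0⟩ := Matrix.exists_mulVec_eq_zero_iff.2 h
  have hpos := hZ.dotProduct_mulVec_pos hx
  set u : Fin n → ℂ := (g.1.1.toBlocks₁₁ * Z + g.1.1.toBlocks₁₂) *ᵥ x with hu
  have hg : g.1.1 *ᵥ Sum.elim (Z *ᵥ x) x = Sum.elim u 0 := by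
    conv_lhs => rw [← Matrix.fromBlocks_toBlocks g.1.1]
    rw [Matrix.fromBlocks_mulVec]
    congr 1
    · simp [hu, Matrix.add_mulVec, Matrix.mulVec_mulVec]
    · simpa [blockC, blockD, Matrix.add_mulVec, Matrix.mulVec_mulVec] using hx0
  have h1 := J_form (Z *ᵥ x) x
  rw [← U_mem g, ← Matrix.mulVec_mulVec, ← Matrix.mulVec_mulVec, Matrix.dotProduct_mulVec,
    ← Matrix.star_mulVec, hg, J_form] at h1
  have h2 : star x ⬝ᵥ (hermIm Z *ᵥ x) = 0 := by
    rw [hermIm, Matrix.smul_mulVec, Matrix.sub_mulVec, dotProduct_smul, dotProduct_sub,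
      Matrix.dotProduct_mulVec (star x) Zᴴ, ← Matrix.star_mulVec, ← neg_sub, ← h1]
    simp
  rw [h2] at hpos
  exact lt_irrefl _ hpos

open scoped ComplexOrder in
theorem hermIm_iPt (n : ℕ) : (hermIm (iPt n)).PosDef := by
  have h : hermIm (iPt n) = 1 := by
    rw [hermIm, iPt, Matrix.conjTranspose_smul, Matrix.conjTranspose_one, ← sub_smul, smul_smul]
    have : 1 / (2 * Complex.I) * (Complex.I - star Complex.I) = 1 := by
      rw [Complex.star_def, Complex.conj_I]
      field_simp
      norm_num
    rw [this, one_smul]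
  rw [h]
  exact Matrix.PosDef.one

/-- `C + D i` for a matrix `(A, B; C, D)`. -/
def lowC (M : Matrix (Fin n ⊕ Fin n) (Fin n ⊕ Fin n) ℂ) : Matrix (Fin n) (Fin n) ℂ :=
  M.toBlocks₂₁ + M.toBlocks₂₂ * iPt n

/-- `C i + D` for a matrix `(A, B; C, D)`. -/
def lowD (M : Matrix (Fin n ⊕ Fin n) (Fin n ⊕ Fin n) ℂ) : Matrix (Fin n) (Fin n) ℂ :=
  M.toBlocks₂₁ * iPt n + M.toBlocks₂₂

theorem det_lowD_ne_zero (g : U n) : (lowD g.1.1).det ≠ 0 :=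
  det_blockC_mul_add_blockD_ne_zero g (hermIm_iPt n)

theorem cayley_inv (n : ℕ) : (cayley n)⁻¹ = (1 / (Real.sqrt 2 : ℂ)) •
    Matrix.fromBlocks 1 (-Complex.I • 1) (-Complex.I • 1) 1 := by
  have h2 : (1 / (Real.sqrt 2 : ℂ)) * (1 / (Real.sqrt 2 : ℂ)) = 1 / 2 := by
    rw [div_mul_div_comm, ← Complex.ofReal_mul, Real.mul_self_sqrt (by norm_num)]
    norm_num
  refine Matrix.inv_eq_right_inv ?_
  rw [cayley, Matrix.smul_mul, Matrix.mul_smul, smul_smul, h2, Matrix.fromBlocks_multiply,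
    Matrix.fromBlocks_smul, ← Matrix.fromBlocks_one]
  congr 1 <;> ext i j <;> simp <;> ring_nf <;> simp <;> ring

/-- The conjugate by the Cayley matrix of an off-diagonal block matrix. -/
def offDiag (p q : Matrix (Fin n) (Fin n) ℂ) : Matrix (Fin n ⊕ Fin n) (Fin n ⊕ Fin n) ℂ :=
  cayley n * Matrix.fromBlocks 0 p q 0 * (cayley n)⁻¹

theorem offDiag_eq (p q : Matrix (Fin n) (Fin n) ℂ) :
    offDiag p q = (1 / 2 : ℂ) • Matrix.fromBlocks (Complex.I • (q - p)) (p + q) (p + q)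
      (Complex.I • (p - q)) := by
  have h2 : (1 / (Real.sqrt 2 : ℂ)) * (1 / (Real.sqrt 2 : ℂ)) = 1 / 2 := by
    rw [div_mul_div_comm, ← Complex.ofReal_mul, Real.mul_self_sqrt (by norm_num)]
    norm_num
  rw [offDiag, cayley_inv, cayley, Matrix.smul_mul, Matrix.smul_mul, Matrix.mul_smul, smul_smul,
    h2, Matrix.fromBlocks_multiply, Matrix.fromBlocks_multiply]
  congr 2
  · simp [sub_eq_add_neg]
  · simp [smul_smul, add_comm]
  · simp [smul_smul, add_comm]
  · simp [sub_eq_add_neg, add_comm]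

/-- The bottom row of `M * cayley n` is `(lowC M, lowD M) / √2`, and right multiplication by `(0, p;
q, 0)` turns it into `(lowD M * q, lowC M * p) / √2`. -/
theorem lowD_mul_offDiag (M : Matrix (Fin n ⊕ Fin n) (Fin n ⊕ Fin n) ℂ)
    (p q : Matrix (Fin n) (Fin n) ℂ) : lowD (M * offDiag p q) = lowC M * p := by
  rw [offDiag_eq, lowD, lowC, iPt]
  conv_lhs => rw [← Matrix.fromBlocks_toBlocks M]
  rw [Matrix.mul_smul (Matrix.fromBlocks _ _ _ _), Matrix.fromBlocks_multiply,
    Matrix.fromBlocks_smul]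
  simp only [Matrix.toBlocks_fromBlocks₂₁, Matrix.toBlocks_fromBlocks₂₂, Matrix.mul_smul,
    Matrix.mul_one, Matrix.mul_add, Matrix.mul_sub, Matrix.add_mul, Matrix.smul_mul]
  ext i j
  simp only [Matrix.add_apply, Matrix.sub_apply, Matrix.smul_apply, smul_eq_mul]
  linear_combination (1 / 2 : ℂ) * ((M.toBlocks₂₁ * q) i j - (M.toBlocks₂₁ * p) i j) *
    Complex.I_mul_I

theorem lowC_mul_offDiag (M : Matrix (Fin n ⊕ Fin n) (Fin n ⊕ Fin n) ℂ)
    (p q : Matrix (Fin n) (Fin n) ℂ) : lowC (M * offDiag p q) = lowD M * q := by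
  rw [offDiag_eq, lowD, lowC, iPt]
  conv_lhs => rw [← Matrix.fromBlocks_toBlocks M]
  rw [Matrix.mul_smul (Matrix.fromBlocks _ _ _ _), Matrix.fromBlocks_multiply,
    Matrix.fromBlocks_smul]
  simp only [Matrix.toBlocks_fromBlocks₂₁, Matrix.toBlocks_fromBlocks₂₂, Matrix.mul_smul,
    Matrix.mul_one, Matrix.mul_add, Matrix.mul_sub, Matrix.add_mul, Matrix.smul_mul]
  ext i j
  simp only [Matrix.add_apply, Matrix.sub_apply, Matrix.smul_apply, smul_eq_mul]
  linear_combination (1 / 2 : ℂ) * ((M.toBlocks₂₂ * p) i j - (M.toBlocks₂₂ * q) i j) *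
    Complex.I_mul_I

theorem offDiag_add (p q p' q' : Matrix (Fin n) (Fin n) ℂ) :
    offDiag p q + offDiag p' q' = offDiag (p + p') (q + q') := by
  simp only [offDiag]
  rw [← add_mul, ← mul_add, Matrix.fromBlocks_add, add_zero]

theorem smul_offDiag (c : ℂ) (p q : Matrix (Fin n) (Fin n) ℂ) :
    c • offDiag p q = offDiag (c • p) (c • q) := by
  simp only [offDiag]
  rw [← Matrix.smul_mul, ← Matrix.mul_smul, Matrix.fromBlocks_smul, smul_zero]

/-- Conjugation with respect to the real form preserves the matrices `offDiag p q`, so the real and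
imaginary parts of `π⁺` stay in this class. -/
theorem J_mul_conjTranspose_offDiag_mul_J (p q : Matrix (Fin n) (Fin n) ℂ) :
    J n * (offDiag p q)ᴴ * J n = offDiag qᴴ pᴴ := by
  rw [offDiag_eq, offDiag_eq, Matrix.conjTranspose_smul, Matrix.fromBlocks_conjTranspose, J,
    Matrix.mul_smul, Matrix.smul_mul, Matrix.fromBlocks_multiply, Matrix.fromBlocks_multiply]
  have h : star (1 / 2 : ℂ) = 1 / 2 := by simp
  rw [h]
  congr 2 <;> simp [add_comm, ← smul_neg]

theorem lieRe_offDiag (p q : Matrix (Fin n) (Fin n) ℂ) :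
    (lieRe (offDiag p q)).1 = offDiag ((1 / 2 : ℂ) • (p + qᴴ)) ((1 / 2 : ℂ) • (q + pᴴ)) := by
  change (1 / 2 : ℂ) • (offDiag p q + J n * (offDiag p q)ᴴ * J n) = _
  rw [J_mul_conjTranspose_offDiag_mul_J, offDiag_add, smul_offDiag]

theorem lieIm_offDiag (p q : Matrix (Fin n) (Fin n) ℂ) :
    (lieIm (offDiag p q)).1 =
      offDiag ((1 / 2 : ℂ) • (-Complex.I • p + Complex.I • qᴴ))
        ((1 / 2 : ℂ) • (-Complex.I • q + Complex.I • pᴴ)) := by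
  rw [lieIm, smul_offDiag, lieRe_offDiag]
  simp

theorem piPlus_eq_offDiag {a : Type*} [DecidableEq a] (x : Entry a n) (v : a) :
    piPlus x v = offDiag (unitFam x v) 0 := by
  by_cases h : v = x.1
  · subst h
    simp [piPlus, unitFam, offDiag]
  · simp [piPlus, unitFam, offDiag, Pi.single_eq_of_ne h]

/-! ### Action of the Lie algebra on `ϱ` and `Δ` -/

open scoped Matrix.Norms.Operator

theorem hasDerivAt_lowD {M : ℝ → Matrix (Fin n ⊕ Fin n) (Fin n ⊕ Fin n) ℂ} {M'} {t₀ : ℝ}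
    (hM : HasDerivAt M M' t₀) : HasDerivAt (fun t => lowD (M t)) (lowD M') t₀ := by
  rw [hasDerivAt_matrix_iff] at hM
  have h1 : HasDerivAt (fun t => (M t).toBlocks₂₁) M'.toBlocks₂₁ t₀ :=
    hasDerivAt_matrix_iff.2 fun i j => hM (Sum.inr i) (Sum.inl j)
  have h2 : HasDerivAt (fun t => (M t).toBlocks₂₂) M'.toBlocks₂₂ t₀ :=
    hasDerivAt_matrix_iff.2 fun i j => hM (Sum.inr i) (Sum.inr j)
  exact (h1.mul_const (iPt n)).add h2

theorem hasDerivAt_lowC {M : ℝ → Matrix (Fin n ⊕ Fin n) (Fin n ⊕ Fin n) ℂ} {M'} {t₀ : ℝ}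
    (hM : HasDerivAt M M' t₀) : HasDerivAt (fun t => lowC (M t)) (lowC M') t₀ := by
  rw [hasDerivAt_matrix_iff] at hM
  have h1 : HasDerivAt (fun t => (M t).toBlocks₂₁) M'.toBlocks₂₁ t₀ :=
    hasDerivAt_matrix_iff.2 fun i j => hM (Sum.inr i) (Sum.inl j)
  have h2 : HasDerivAt (fun t => (M t).toBlocks₂₂) M'.toBlocks₂₂ t₀ :=
    hasDerivAt_matrix_iff.2 fun i j => hM (Sum.inr i) (Sum.inr j)
  exact h1.add (h2.mul_const (iPt n))

theorem hasDerivAt_mul_expU (g : U n) (X : lieU n) :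
    HasDerivAt (fun t : ℝ => (g * expU (t • X)).1.1) (g.1.1 * X.1) 0 := by
  have h := (hasDerivAt_exp_smul_const (𝕂 := ℝ) X.1 0).const_mul g.1.1
  refine h.congr_deriv ?_
  simp

theorem hasDerivAt_norm_cpow_mul_zpow {d : ℝ → ℂ} {τ : ℂ} {t₀ : ℝ}
    (hd : HasDerivAt d (d t₀ * τ) t₀) (h0 : d t₀ ≠ 0) (c : ℂ) (m : ℤ) :
    HasDerivAt (fun t => ((‖d t‖ : ℝ) : ℂ) ^ c * d t ^ m)
      (((‖d t₀‖ : ℝ) : ℂ) ^ c * d t₀ ^ m * (c * τ.re + m * τ)) t₀ := by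
  have hn0 : ‖d t₀‖ ≠ 0 := norm_ne_zero_iff.2 h0
  have hn : HasDerivAt (fun t => ‖d t‖) (‖d t₀‖ * τ.re) t₀ := by
    have h1 := hd.norm_sq.sqrt (pow_ne_zero 2 hn0)
    simp only [Real.sqrt_sq (norm_nonneg _)] at h1
    refine h1.congr_deriv ?_
    -- The real inner product of `d` and `d τ` is `|d|² Re τ`: the modulus sees only the real part
    -- of the logarithmic derivative.
    have h2 : inner ℝ (d t₀) (d t₀ * τ) = ‖d t₀‖ ^ 2 * τ.re := by
      rw [← Complex.normSq_eq_norm_sq, Complex.normSq_apply]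
      simp [Complex.inner]
      ring
    rw [h2]
    field_simp
  have hz : ((‖d t₀‖ : ℝ) : ℂ) ≠ 0 := Complex.ofReal_ne_zero.2 hn0
  have h1 : HasDerivAt (fun t => ((‖d t‖ : ℝ) : ℂ) ^ c)
      (((‖d t₀‖ : ℝ) : ℂ) ^ c * (c * τ.re)) t₀ := by
    have hs : ((‖d t₀‖ : ℝ) : ℂ) ∈ Complex.slitPlane := by
      rw [Complex.ofReal_mem_slitPlane]
      exact norm_pos_iff.2 h0
    have h2 := ((hasDerivAt_id _).cpow_const (c := c) hs).comp t₀ hn.ofReal_comp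
    refine h2.congr_deriv ?_
    change c * ((‖d t₀‖ : ℝ) : ℂ) ^ (c - 1) * 1 * ((‖d t₀‖ * τ.re : ℝ) : ℂ) = _
    rw [Complex.ofReal_mul]
    rw [Complex.cpow_sub _ _ hz, Complex.cpow_one]
    field_simp
  have h3 : HasDerivAt (fun t => d t ^ m) (d t₀ ^ m * (m * τ)) t₀ := by
    refine ((hasDerivAt_zpow m (d t₀) (.inl h0)).comp t₀ hd).congr_deriv ?_
    rw [zpow_sub_one₀ h0]
    field_simp
  refine (h1.fun_mul h3).congr_deriv ?_
  ring

variable {a : Type*} [Fintype a]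

/-- Along `g exp(tX)`, `lowD` moves by `lowC * p` and `lowC` by `lowD * q`, so `Δ' = q - Δ p Δ`,
while `det (lowD)` has logarithmic derivative `tr (Δ p)`. -/
theorem rightDeriv_rhoFun_mul_evalFam (κ : a → ℕ) (s : ℂ) (Q : MvPolynomial (Entry a n) ℂ)
    (X : a → lieU n) (p q : MatFam a n) (hX : ∀ v, (X v).1 = offDiag (p v) (q v)) (g : a → U n) :
    rightDeriv X (fun g => rhoFun κ s g * evalFam (DeltaG g) Q) g =
      rhoFun κ s g * ((∑ v, (((κ v : ℂ) - 2 * s) * ((DeltaG g v * p v).trace.re : ℂ) -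
          κ v * (DeltaG g v * p v).trace)) * evalFam (DeltaG g) Q +
        ∑ y : Entry a n, (q y.1 - DeltaG g y.1 * p y.1 * DeltaG g y.1) y.2.1 y.2.2 *
          evalFam (DeltaG g) (MvPolynomial.pderiv y Q)) := by
  have hM (v : a) := hasDerivAt_mul_expU (g v) (X v)
  simp only [hX] at hM
  have e0 (v : a) : (g v * expU ((0 : ℝ) • X v)).1.1 = (g v).1.1 := by
    rw [zero_smul]
    change (g v).1.1 * NormedSpace.exp 0 = _
    rw [NormedSpace.exp_zero, mul_one]
  have hD (v : a) := hasDerivAt_lowD (hM v)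
  have hC (v : a) := hasDerivAt_lowC (hM v)
  simp only [lowD_mul_offDiag, lowC_mul_offDiag] at hD hC
  have h0 (v : a) : (lowD (g v * expU ((0 : ℝ) • X v)).1.1).det ≠ 0 := det_lowD_ne_zero _
  have hr := hasDerivAt_prod_of_log fun v => hasDerivAt_norm_cpow_mul_zpow
    (hasDerivAt_det (hD v) (h0 v)) (h0 v) ((κ v : ℂ) - 2 * s) (-(κ v : ℤ))
  have key := hasDerivAt_mul_evalFam hr hD hC h0 Q
  have hdef := key.deriv
  simp only [e0] at hdef
  refine Eq.trans hdef ?_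
  have hΔ (v : a) : (lowD (g v).1.1)⁻¹ * lowC (g v).1.1 = DeltaG g v := rfl
  have hq (v : a) : (lowD (g v).1.1)⁻¹ * (lowD (g v).1.1 * q v) = q v :=
    Matrix.nonsing_inv_mul_cancel_left _ _ (det_lowD_ne_zero (g v)).isUnit
  simp only [hq, ← Matrix.mul_assoc _ (lowC _) (p _), hΔ, Int.cast_neg, Int.cast_natCast, neg_mul,
    ← sub_eq_add_neg]
  rfl

variable [DecidableEq a]

theorem rightDerivC_rhoFun_mul_evalFam (κ : a → ℕ) (s : ℂ) (Q : MvPolynomial (Entry a n) ℂ)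
    (x : Entry a n) (g : a → U n) :
    rightDerivC (piPlus x) (fun g => rhoFun κ s g * evalFam (DeltaG g) Q) g =
      rhoFun κ s g * ((∑ v, -((κ v : ℂ) / 2 + s) * (DeltaG g v * unitFam x v).trace) *
          evalFam (DeltaG g) Q -
        ∑ y : Entry a n, (DeltaG g y.1 * unitFam x y.1 * DeltaG g y.1) y.2.1 y.2.2 *
          evalFam (DeltaG g) (MvPolynomial.pderiv y Q)) := by
  rw [rightDerivC, rightDeriv_rhoFun_mul_evalFam κ s Q _ (fun v => (1 / 2 : ℂ) • unitFam x v)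
      (fun v => (1 / 2 : ℂ) • (unitFam x v)ᴴ)
      (fun v => by rw [piPlus_eq_offDiag, lieRe_offDiag]; simp),
    rightDeriv_rhoFun_mul_evalFam κ s Q _ (fun v => (-Complex.I / 2) • unitFam x v)
      (fun v => (Complex.I / 2) • (unitFam x v)ᴴ)
      (fun v => by
        rw [piPlus_eq_offDiag, lieIm_offDiag]
        simp only [Matrix.conjTranspose_zero, smul_zero, add_zero, zero_add, smul_smul]
        congr 2 <;> ring)]
  -- Recombining the real parts as `X₁ + i X₂` restores `τ / 2`, so the exponents add up to `(κ -
  -- 2s)/2 - κ = -(κ/2 + s)`.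
  have hτ (τ : ℂ) : ((((1 / 2 : ℂ) * τ).re : ℝ) : ℂ) +
      Complex.I * ((((-Complex.I / 2) * τ).re : ℝ) : ℂ) = τ / 2 := by
    apply Complex.ext <;> simp <;> ring
  have h1 : ∑ v, -((κ v : ℂ) / 2 + s) * (DeltaG g v * unitFam x v).trace =
      ∑ v, (((κ v : ℂ) - 2 * s) * ((DeltaG g v * (1 / 2 : ℂ) • unitFam x v).trace.re : ℂ) -
          κ v * (DeltaG g v * (1 / 2 : ℂ) • unitFam x v).trace) +
      Complex.I *
        ∑ v, (((κ v : ℂ) - 2 * s) * ((DeltaG g v * (-Complex.I / 2) • unitFam x v).trace.re : ℂ) -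
          κ v * (DeltaG g v * (-Complex.I / 2) • unitFam x v).trace) := by
    rw [Finset.mul_sum, ← Finset.sum_add_distrib]
    refine Finset.sum_congr rfl fun v _ => ?_
    simp only [Matrix.mul_smul, Matrix.trace_smul, smul_eq_mul]
    set τ := (DeltaG g v * unitFam x v).trace
    linear_combination (-((κ v : ℂ) - 2 * s)) * hτ τ - (κ v : ℂ) * τ / 2 * Complex.I_mul_I
  -- The adjoint terms cancel because `1/2 + i (i/2) = 0`; the terms in `E` add up because `1/2 + i
  -- (-i/2) = 1`.
  have h2 : -∑ y : Entry a n, (DeltaG g y.1 * unitFam x y.1 * DeltaG g y.1) y.2.1 y.2.2 *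
          evalFam (DeltaG g) (MvPolynomial.pderiv y Q) =
      ∑ y : Entry a n, ((1 / 2 : ℂ) • (unitFam x y.1)ᴴ -
          DeltaG g y.1 * (1 / 2 : ℂ) • unitFam x y.1 * DeltaG g y.1) y.2.1 y.2.2 *
          evalFam (DeltaG g) (MvPolynomial.pderiv y Q) +
      Complex.I * ∑ y : Entry a n, ((Complex.I / 2) • (unitFam x y.1)ᴴ -
          DeltaG g y.1 * (-Complex.I / 2) • unitFam x y.1 * DeltaG g y.1) y.2.1 y.2.2 *
          evalFam (DeltaG g) (MvPolynomial.pderiv y Q) := by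
    rw [Finset.mul_sum, ← Finset.sum_add_distrib, ← Finset.sum_neg_distrib]
    refine Finset.sum_congr rfl fun y _ => ?_
    simp only [Matrix.mul_smul, Matrix.smul_mul, Matrix.sub_apply, Matrix.smul_apply, smul_eq_mul]
    linear_combination (-(1 / 2 : ℂ)) * ((unitFam x y.1)ᴴ y.2.1 y.2.2 +
      (DeltaG g y.1 * unitFam x y.1 * DeltaG g y.1) y.2.1 y.2.2) *
      evalFam (DeltaG g) (MvPolynomial.pderiv y Q) * Complex.I_mul_I
  rw [sub_eq_add_neg, h1, h2]
  ring

theorem foldr_rightDerivC_rhoFun (κ : a → ℕ) (s : ℂ) (L : List (Entry a n)) :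
    L.foldr (fun x => rightDerivC (piPlus x)) (rhoFun κ s) = fun g =>
      rhoFun κ s g * evalFam (DeltaG g) (jetPoly (fun v => (κ v : ℂ) / 2 + s) L) := by
  induction L with
  | nil => simp [jetPoly, evalFam]
  | cons x L ih =>
    funext g
    rw [List.foldr_cons, ih, rightDerivC_rhoFun_mul_evalFam, evalFam_jetPoly_cons]

end Group

/-! ### From monomials to homogeneous polynomials, and the two formulas -/

section Main

variable {a : Type*} [Fintype a] [DecidableEq a] {n : ℕ}

/-- A relation between iterated operators of length `d` extends to homogeneous polynomials in them. -/
theorem polyApply_eq_mul_polyApply {σ X Y : Type*} {D : σ → (X → ℂ) → X → ℂ}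
    {D' : σ → (Y → ℂ) → Y → ℂ} {P : MvPolynomial σ ℂ} {d : ℕ} (hP : P.IsHomogeneous d)
    {f : X → ℂ} {f' : Y → ℂ} {x : X} {y : Y} {c : ℂ}
    (h : ∀ L : List σ, L.length = d → L.foldr D f x = c * ((-1) ^ d * L.foldr D' f' y)) :
    polyApply D P f x = c * ((-1) ^ d * polyApply D' P f' y) := by
  simp only [polyApply, Finset.mul_sum]
  refine Finset.sum_congr rfl fun ν hν => ?_
  rw [h]
  · ring
  -- Each monomial in the support has degree `d`, which is the length of its list of operators.
  · rw [Multiset.length_toList, Finsupp.card_toMultiset, ← hP (MvPolynomial.mem_support_iff.1 hν),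
      Finsupp.weight_apply]
    simp [Finsupp.sum]

theorem polyApply_deltaPow {d : ℕ} {P : MvPolynomial (Entry a n) ℂ} (hP : P.IsHomogeneous d)
    (κ : a → ℕ) (g : a → U n) {Z : MatFam a n} (hZ : Z ∈ upperHalf a n) :
    polyApply partialZ P (deltaPow κ g) Z =
      deltaPow κ g Z * phi κ d P (fun v => (DeltaZ g Z v)ᵀ) := by
  refine polyApply_eq_mul_polyApply hP fun L hL => ?_
  set Φ : MatFam a n → ℂ := fun W =>
    ∏ v, (1 - W v * (DeltaZ g Z v)ᵀᵀ).det ^ (-(κ v : ℤ)) with hΦ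
  -- `C (Z + W) + D = (C Z + D) (1 + Δ W)`, and `det (1 + Δ W) = det (1 + W Δ)` by Sylvester's
  -- identity.
  have h : (fun W => deltaPow κ g (Z + W)) = fun W => deltaPow κ g Z * Φ (-W) := by
    funext W
    rw [deltaPow, deltaPow, hΦ, ← Finset.prod_mul_distrib]
    refine Finset.prod_congr rfl fun v _ => ?_
    have h0 := det_blockC_mul_add_blockD_ne_zero (g v) (hZ v)
    rw [← mul_zpow, Matrix.transpose_transpose, Pi.neg_apply, neg_mul, sub_neg_eq_add,
      Matrix.det_one_add_mul_comm, ← Matrix.det_mul, mul_add, mul_one, ← Matrix.mul_assoc, DeltaZ,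
      Matrix.mul_nonsing_inv_cancel_left _ _ h0.isUnit, Pi.add_apply, mul_add]
    congr 2
    abel
  have h1 := congrFun (foldr_partialZ_translate Z (deltaPow κ g) L) 0
  rw [h, foldr_partialZ_const_mul, foldr_partialZ_neg] at h1
  simp only [add_zero, neg_zero, hL] at h1
  exact h1.symm

theorem polyApply_rhoFun {d : ℕ} {P : MvPolynomial (Entry a n) ℂ} (hP : P.IsHomogeneous d)
    (κ : a → ℕ) (s : ℂ) (g : a → U n) :
    polyApply (fun x => rightDerivC (piPlus x)) P (rhoFun κ s) g =
      rhoFun κ s g * psi κ s d P (fun v => (DeltaG g v)ᵀ) := by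
  refine polyApply_eq_mul_polyApply hP fun L hL => ?_
  have h1 := congrFun (foldr_partialZ_neg (fun W : MatFam a n =>
    ∏ v, (1 - W v * (DeltaG g v)ᵀᵀ).det ^ (-((κ v : ℂ) / 2 + s))) L) 0
  simp only [Matrix.transpose_transpose, Pi.neg_apply, neg_mul, sub_neg_eq_add,
    Matrix.det_one_add_mul_comm _ (DeltaG g _), neg_zero] at h1 ⊢
  -- At `W = 0` every determinant is `1`, which lies in the slit plane, and the matrix `T` of the
  -- recursion is `Δ(g)`.
  rw [← hL, ← h1, foldr_rightDerivC_rhoFun,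
    foldr_partialZ_prod_det_cpow (fun v => (κ v : ℂ) / 2 + s) (DeltaG g) L 0 (by simp)]
  simp

end Main

end HermitianDiff

end

theorem mainTheorem6 {a : Type*} [Fintype a] [DecidableEq a] (n d : ℕ) (hn : 0 < n)
    (κ : a → ℕ) (hκ : ∀ v, 0 < κ v)
    (P : MvPolynomial (HermitianDiff.Entry a n) ℂ) (hP : P.IsHomogeneous d) :
    ((∀ v, n ≤ κ v) →
      ∀ (g : a → HermitianDiff.U n), ∀ Z ∈ HermitianDiff.upperHalf a n,
        HermitianDiff.polyApply HermitianDiff.partialZ P (HermitianDiff.deltaPow κ g) Z =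
          HermitianDiff.deltaPow κ g Z *
            HermitianDiff.phi κ d P (fun v => (HermitianDiff.DeltaZ g Z v)ᵀ)) ∧
    (∀ s : ℂ, (∀ v, (n : ℝ) ≤ ((κ v : ℂ) / 2 + s).re) →
      ∀ g : a → HermitianDiff.U n,
        HermitianDiff.polyApply
            (fun x => HermitianDiff.rightDerivC (HermitianDiff.piPlus x)) P
            (HermitianDiff.rhoFun κ s) g =
          HermitianDiff.rhoFun κ s g *
            HermitianDiff.psi κ s d P (fun v => (HermitianDiff.DeltaG g v)ᵀ)) := by
  exact ⟨fun _ g _ hZ => HermitianDiff.polyApply_deltaPow hP κ g hZ,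
    fun s _ g => HermitianDiff.polyApply_rhoFun hP κ s g⟩
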